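/- **Setting.** Norms on $\mathbb{R}^m$ are Euclidean, norms of linear maps are operator norms. Let $M$ be a compact smooth $d$-manifold without boundary, smoothly embedded in $\mathbb{R}^N$; $T_xM\subset\mathbb{R}^N$ carries the induced norm. A *good cover* of $M$ is a finite cover $\{U_i\}_{i\in I}$ by contractible open subsets $U_i\subset M$ such that every connected component of every nonempty intersection of two or more of the $U_i$ is contractible. The $C^1$ norm of a map is $\|f\|_{C^1(S)}=\sup_S\|f\|+\sup_S\|df\|$ (with $df_x$ taken on $T_xM$ if $S\subset M$), and the $C^2$ norm on an open set of $\mathbb{R}^d$ has the further summand $\sup\|d^2f\|$. An *$(\varepsilon,\eta)$-approximate autoencoder atlas* $\mathcal A=\{(U_i,E_i,D_i)\}_{i\in I}$ over $\{U_i\}$ consists of $C^1$ maps $E_i\colon O_i\to\mathbb{R}^d$ and $D_i\colon W_i\to\mathbb{R}^N$, where $O_i\subset\mathbb{R}^N$ and $W_i\subset\mathbb{R}^d$ are open, $O_i$ contains the closed $\varepsilon$-neighbourhood of $U_i$ in $\mathbb{R}^N$, and $W_i\supset E_i(U_i)$, such that for all $i$ and $x\in U_i$ $$\|D_i(E_i(x))-x\|\le\varepsilon,\qquad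 \|d(D_i\circ E_i)_x w-w\|\le\eta\|w\|\quad (w\in T_xM).$$ For $x\in U_i\cap U_j$ put $g_{ji}(x)=d(E_j\circ D_i)_{E_i(x)}\in\mathbb{R}^{d\times d}$, $\omega_{ji}(x)=\operatorname{sign}\det g_{ji}(x)$, and let $\delta(\mathcal A)=\inf|\det g_{ji}(x)|$ over all $i,j\in I$ and $x\in U_i\cap U_j$. An *exact atlas* $\mathcal A_0=\{(U_i,E_i^0,D_i^0)\}_{i\in I}$ over the same cover, compatible with the smooth structure, consists of smooth charts $E_i^0\colon U_i\to Z_i^0$ of $M$ onto open sets $Z_i^0\subset\mathbb{R}^d$, with inverses $D_i^0$; $\delta(\mathcal A_0)$ is defined in the same way. We say that its $C^2$ norms are at most $K$ if this holds for the $C^1$ norms of the $E_i^0$ on $U_i$, the $C^2$ norms of the $D_i^0\colon Z_i^0\to\mathbb{R}^N$, and the $C^2$ norms of the transition maps $E_j^0\circ D_i^0$ on $E_i^0(U_i\cap U_j)$. $M$ is *orientable* if the structure group of $TM$ can be reduced to $\mathrm{GL}_d^+(\mathbb{R})$, i.e. $M$ is covered by local trivializations of $TM$ whose transition matrices all have positive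 determinant. **Corollary 4.12.** Let $M\subset\mathbb{R}^N$ be as above. For all $n\in\mathbb{N}$ and $K\ge0$ there is a constant $C_0>0$, depending only on the embedded manifold $M$, on $n$ and on $K$, with the following property. Let $\{U_i\}_{i\in I}$ be a good cover of $M$ with $|I|=n$, and let $\mathcal A$ be an $(\varepsilon,\eta)$-approximate autoencoder atlas over it such that: 1. (*Regularity and non-degeneracy.*) $\delta(\mathcal A)>0$, and there are constants $L_E,L_E',L_D,L_D'$ such that for all $i$, $E_i(O_i)\subset W_i$ and, for all $p,q\in O_i$ and $z,z'\in E_i(O_i)$, $$\|d(E_i)_p\|\le L_E,\quad \|d(E_i)_p-d(E_i)_q\|\le L_E'\|p-q\|,\quad \|d(D_i)_z\|\le L_D,\quad \|d(D_i)_z-d(D_i)_{z'}\|\le L_D'\|z-z'\|,$$ and $\eta<1$ and $$\max\bigl(d\,\Gamma\,(L_EL_D+\Gamma)^{d-1},\;L_{\det}\,\varepsilon\bigr)<\delta(\mathcal A)$$ (both terms being $0$ if $d=0$), where $$\eta_{\mathrm{eff}}=\frac{(L_EL_D+2)\eta}{1-\eta}+(L_D'L_E^2+L_DL_E')\,\varepsilon,$$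 $$\Gamma=L_E\,\eta_{\mathrm{eff}}\,L_D+L_E'(L_EL_D+2)\,\varepsilon\,(1+\eta_{\mathrm{eff}})\,L_D,$$ $$L_{\det}=d\,(L_EL_D)^{d-1}L_E\,(L_EL_D'+L_E'L_D^2).$$ 2. (*Proximity to an exact atlas.*) There are an exact atlas $\mathcal A_0$ over $\{U_i\}$, compatible with the smooth structure of $M$, with $C^2$ norms at most $K$ and $\delta(\mathcal A_0)>0$, and a number $\mu\ge0$, such that for all $i$, $Z_i^0\subset W_i$, $$\|E_i-E_i^0\|_{C^1(U_i)}\le\mu,\qquad \|D_i-D_i^0\|_{C^1(Z_i^0)}\le\mu,\qquad\text{and}\qquad \mu<\frac{\delta(\mathcal A_0)}{2C_0}.$$ Then $M$ is orientable if and only if there are signs $\nu_i\in\{-1,+1\}$, $i\in I$, such that $$\omega_{ji}(x)=\nu_j\,\nu_i\qquad\text{for all } i,j\in I \text{ and all } x\in U_i\cap U_j.$$ -/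

import Mathlib

open scoped Manifold ContDiff ENNReal NNReal
open Bundle

noncomputable section

/-- `ℝⁿ` with the Euclidean norm. -/
abbrev Euc (n : ℕ) : Type := EuclideanSpace ℝ (Fin n)

/-! ### Orientability -/

/-- A real vector bundle of rank `k` is orientable if its structure group can be reduced from
`GL_k(ℝ)` to `GL_k⁺(ℝ)`: the base is covered by (continuous, fibrewise linear) local
trivializations all of whose coordinate changes have positive determinant. -/
def IsOrientableBundle (k : ℕ) {B : Type*} [TopologicalSpace B] (V : B → Type*)
    [∀ b, AddCommGroup (V b)] [∀ b, Module ℝ (V b)] [∀ b, TopologicalSpace (V b)]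
    [TopologicalSpace (TotalSpace (Euc k) V)] [FiberBundle (Euc k) V]
    [VectorBundle ℝ (Euc k) V] : Prop :=
  ∃ S : Set (Trivialization (Euc k) (π (Euc k) V)),
    (∀ e ∈ S, e.IsLinear ℝ) ∧
    (∀ b : B, ∃ e ∈ S, b ∈ e.baseSet) ∧
    ∀ (e e' : Trivialization (Euc k) (π (Euc k) V)) [e.IsLinear ℝ] [e'.IsLinear ℝ],
      e ∈ S → e' ∈ S → ∀ b ∈ e.baseSet ∩ e'.baseSet,
        0 < LinearMap.det (e.coordChangeL ℝ e' b : Euc k →ₗ[ℝ] Euc k)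

/-- A smooth `d`-manifold (without boundary) is orientable if its tangent bundle is. -/
def IsOrientableManifold (d : ℕ) (M : Type*) [TopologicalSpace M] [ChartedSpace (Euc d) M]
    [IsManifold (𝓡 d) ∞ M] : Prop :=
  haveI : IsManifold (𝓡 d) 1 M := IsManifold.of_le (n := ∞) (by norm_cast)
  IsOrientableBundle d (fun x : M => TangentSpace (𝓡 d) x)

/-! ### Good covers -/

/-- A (relaxed) good cover: an open cover by finitely many contractible sets such that every
connected component of every nonempty intersection of two or more of them is contractible. -/
structure IsGoodCover {X I : Type*} [TopologicalSpace X] [Fintype I] (U : I → Set X) : Prop where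
  isOpen : ∀ i, IsOpen (U i)
  covers : ⋃ i, U i = Set.univ
  contractible : ∀ i, ContractibleSpace (U i)
  contractible_component : ∀ s : Finset I, 2 ≤ s.card → ∀ x ∈ ⋂ i ∈ s, U i,
    ContractibleSpace (connectedComponentIn (⋂ i ∈ s, U i) x)

/-! ### Norms -/

/-- The `C¹` norm `sup ‖f‖ + sup ‖df‖` on an open subset of a Euclidean space
(possibly infinite). -/
def c1Norm {m n : ℕ} (f : Euc m → Euc n) (s : Set (Euc m)) : ℝ≥0∞ :=
  (⨆ z ∈ s, ‖f z‖ₑ) + ⨆ z ∈ s, ‖fderiv ℝ f z‖ₑ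

/-- The `C²` norm `sup ‖f‖ + sup ‖df‖ + sup ‖d²f‖` on an open subset of a Euclidean space
(possibly infinite). -/
def c2Norm {m n : ℕ} (f : Euc m → Euc n) (s : Set (Euc m)) : ℝ≥0∞ :=
  c1Norm f s + ⨆ z ∈ s, ‖iteratedFDeriv ℝ 2 f z‖ₑ

/-! ### The non-degeneracy gap -/

/-- The infimum of `|det g_{ji}(x)|` over all `i`, `j` and all `x ∈ U i ∩ U j`. -/
def nondegeneracyGap {d : ℕ} {X I : Type*} (U : I → Set X)
    (g : I → I → X → (Euc d →L[ℝ] Euc d)) : ℝ :=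
  sInf {r : ℝ | ∃ i j, ∃ x ∈ U i ∩ U j, r = |(g j i x).det|}

section Manifold

variable (d : ℕ) {N : ℕ} {M : Type*} [TopologicalSpace M] [ChartedSpace (Euc d) M]

/-- The differential at `x` of a map from `M` to a Euclidean space. -/
def mdiff {m : ℕ} (f : M → Euc m) (x : M) : TangentSpace (𝓡 d) x →L[ℝ] Euc m :=
  mfderiv (𝓡 d) 𝓘(ℝ, Euc m) f x

/-- The tangent space `T_x M` of the embedded manifold `ι : M → ℝᴺ`, as a subspace of `ℝᴺ`. -/
def embeddedTangentSpace (ι : M → Euc N) (x : M) : Submodule ℝ (Euc N) :=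
  LinearMap.range (mdiff d ι x).toLinearMap

/-- The `C¹` norm `sup ‖f‖ + sup ‖df‖` on a subset of the manifold `M` embedded by `ι` in `ℝᴺ`
(possibly infinite). The operator norm of `df_x` is `sup ‖df_x v‖` over the tangent vectors `v`
that are unit vectors of `ℝᴺ`. -/
def c1NormAlong (ι : M → Euc N) {n : ℕ} (f : M → Euc n) (s : Set M) : ℝ≥0∞ :=
  (⨆ x ∈ s, ‖f x‖ₑ) +
    ⨆ x ∈ s, ⨆ (v : TangentSpace (𝓡 d) x) (_ : ‖mdiff d ι x v‖ = 1), ‖mdiff d f x v‖ₑ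

/-! ### Approximate autoencoder atlases -/

/-- An `(ε, η)`-approximate autoencoder atlas over the family `U` of subsets of the manifold `M`
embedded by `ι` in `ℝᴺ`. The encoder `enc i` is a map on the open set `encDom i`, the decoder
`dec i` is a map on the open set `decDom i`; their values elsewhere are irrelevant. -/
structure ApproxAtlas (ι : M → Euc N) {I : Type*} (U : I → Set M) (ε η : ℝ) where
  enc : I → Euc N → Euc d
  encDom : I → Set (Euc N)
  dec : I → Euc d → Euc N
  decDom : I → Set (Euc d)
  isOpen_encDom : ∀ i, IsOpen (encDom i)
  subset_encDom : ∀ i, ι '' U i ⊆ encDom i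
  contDiffOn_enc : ∀ i, ContDiffOn ℝ 1 (enc i) (encDom i)
  isOpen_decDom : ∀ i, IsOpen (decDom i)
  subset_decDom : ∀ i, enc i '' (ι '' U i) ⊆ decDom i
  contDiffOn_dec : ∀ i, ContDiffOn ℝ 1 (dec i) (decDom i)
  /-- pointwise reconstruction error -/
  reconstruction : ∀ i, ∀ x ∈ U i, ‖dec i (enc i (ι x)) - ι x‖ ≤ ε
  /-- differential reconstruction error, on tangent vectors -/
  differential_reconstruction : ∀ i, ∀ x ∈ U i, ∀ w ∈ embeddedTangentSpace d ι x,
    ‖fderiv ℝ (dec i ∘ enc i) (ι x) w - w‖ ≤ η * ‖w‖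
  /-- the encoder domain contains the closed `ε`-neighbourhood of the chart domain -/
  cthickening_subset : ∀ i, Metric.cthickening ε (ι '' U i) ⊆ encDom i

namespace ApproxAtlas

variable {d} {ι : M → Euc N} {I : Type*} {U : I → Set M} {ε η : ℝ}

/-- `g_{ji}(x)`, the differential of `E_j ∘ D_i` at `E_i(x)`. -/
def jac (A : ApproxAtlas d ι U ε η) (j i : I) (x : M) : Euc d →L[ℝ] Euc d :=
  fderiv ℝ (A.enc j ∘ A.dec i) (A.enc i (ι x))

/-- `ω_{ji}(x) = sign (det g_{ji}(x))`. -/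
def sgn (A : ApproxAtlas d ι U ε η) (j i : I) (x : M) : ℝ :=
  Real.sign (A.jac j i x).det

/-- The non-degeneracy gap of the atlas. -/
def gap (A : ApproxAtlas d ι U ε η) : ℝ := nondegeneracyGap U A.jac

/-- The uniform bounds on the first derivatives of the encoders and decoders, and on the Lipschitz
constants of these derivatives, on the extended encoder domains and their images. -/
structure RegularityBounds (A : ApproxAtlas d ι U ε η) (LE LE' LD LD' : ℝ) : Prop where
  image_subset_decDom : ∀ i, A.enc i '' A.encDom i ⊆ A.decDom i
  enc_bound : ∀ i, ∀ p ∈ A.encDom i, ‖fderiv ℝ (A.enc i) p‖ ≤ LE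
  enc_lipschitz : ∀ i, ∀ p ∈ A.encDom i, ∀ q ∈ A.encDom i,
    ‖fderiv ℝ (A.enc i) p - fderiv ℝ (A.enc i) q‖ ≤ LE' * ‖p - q‖
  dec_bound : ∀ i, ∀ z ∈ A.enc i '' A.encDom i, ‖fderiv ℝ (A.dec i) z‖ ≤ LD
  dec_lipschitz : ∀ i, ∀ z ∈ A.enc i '' A.encDom i, ∀ z' ∈ A.enc i '' A.encDom i,
    ‖fderiv ℝ (A.dec i) z - fderiv ℝ (A.dec i) z'‖ ≤ LD' * ‖z - z'‖

end ApproxAtlas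

/-! ### Exact atlases -/

/-- An exact smooth autoencoder atlas over the family `U`, compatible with the smooth structure
of `M`: the encoder of `U i` is a smooth chart `chart i` of `M` with domain `U i`, and the decoder
is its inverse, followed by the embedding when viewed as a map to `ℝᴺ`. -/
structure ExactAtlas [IsManifold (𝓡 d) ∞ M] {I : Type*} (U : I → Set M) where
  chart : I → OpenPartialHomeomorph M (Euc d)
  chart_mem : ∀ i, chart i ∈ IsManifold.maximalAtlas (𝓡 d) ∞ M
  source_eq : ∀ i, (chart i).source = U i

namespace ExactAtlas

variable {d} [IsManifold (𝓡 d) ∞ M] {I : Type*} {U : I → Set M}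

/-- The transition map `E_j ∘ D_i`, meaningful on `E_i(U i ∩ U j)`. -/
def trans (A : ExactAtlas d U) (j i : I) : Euc d → Euc d :=
  A.chart j ∘ (A.chart i).symm

/-- `g_{ji}(x)`, the differential of the transition map at `E_i(x)`. -/
def jac (A : ExactAtlas d U) (j i : I) (x : M) : Euc d →L[ℝ] Euc d :=
  fderiv ℝ (A.trans j i) (A.chart i x)

/-- The non-degeneracy gap of the atlas. -/
def gap (A : ExactAtlas d U) : ℝ := nondegeneracyGap U A.jac

/-- All `C²` norms of the atlas are at most `K`: those of the decoders (as maps to `ℝᴺ`), those of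
the encoders read in the charts of the atlas, i.e. of the transition maps, and the `C¹` norms
of the encoders along the embedded manifold. -/
structure C2Bound (A : ExactAtlas d U) (ι : M → Euc N) (K : ℝ≥0) : Prop where
  enc : ∀ i, c1NormAlong d ι (A.chart i) (U i) ≤ K
  dec : ∀ i, c2Norm (ι ∘ (A.chart i).symm) (A.chart i).target ≤ K
  trans : ∀ i j, c2Norm (A.trans j i) (A.chart i '' (U i ∩ U j)) ≤ K

end ExactAtlas

/-- The approximate atlas `A` is `μ`-close in `C¹` to the exact atlas `A₀`:
`‖E_i - E_i⁰‖_{C¹(U i)} ≤ μ` and `‖D_i - D_i⁰‖_{C¹(Z_i⁰)} ≤ μ` with `Z_i⁰ = E_i⁰(U i)`, where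
the decoder `D_i` is defined on `Z_i⁰`. -/
structure C1Close {d : ℕ} {N : ℕ} {M : Type*} [TopologicalSpace M] [ChartedSpace (Euc d) M]
    [IsManifold (𝓡 d) ∞ M] {ι : M → Euc N} {I : Type*} {U : I → Set M} {ε η : ℝ}
    (A : ApproxAtlas d ι U ε η) (A₀ : ExactAtlas d U) (μ : ℝ) : Prop where
  target_subset : ∀ i, (A₀.chart i).target ⊆ A.decDom i
  enc : ∀ i, c1NormAlong d ι (fun x => A.enc i (ι x) - A₀.chart i x) (U i) ≤ ENNReal.ofReal μ
  dec : ∀ i, c1Norm (fun z => A.dec i z - ι ((A₀.chart i).symm z)) (A₀.chart i).target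
    ≤ ENNReal.ofReal μ

end Manifold

/-! ### The constants of the stability condition -/

/-- `L_Φ' = L_D' L_E² + L_D L_E'`. -/
def reconLip (LE LE' LD LD' : ℝ) : ℝ := LD' * LE ^ 2 + LD * LE'

/-- `η_eff = (L_E L_D + 2) η / (1 - η) + L_Φ' ε`. -/
def etaEff (ε η LE LE' LD LD' : ℝ) : ℝ :=
  (LE * LD + 2) * η / (1 - η) + reconLip LE LE' LD LD' * ε

/-- `Γ = L_E η_eff L_D + L_E' (L_E L_D + 2) ε (1 + η_eff) L_D`. -/
def perturbation (ε η LE LE' LD LD' : ℝ) : ℝ :=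
  LE * etaEff ε η LE LE' LD LD' * LD +
    LE' * ((LE * LD + 2) * ε) * (1 + etaEff ε η LE LE' LD LD') * LD

/-- `L_det = d (L_E L_D)^(d-1) L_E (L_E L_D' + L_E' L_D²)`; it is `0` for `d = 0`. -/
def detLip (d : ℕ) (LE LE' LD LD' : ℝ) : ℝ :=
  d * (LE * LD) ^ (d - 1) * LE * (LE * LD' + LE' * LD ^ 2)

/-- `η < 1` and `max (d Γ (L_E L_D + Γ)^(d-1), L_det ε) < δ`. -/
def StabilityCondition (d : ℕ) (ε η LE LE' LD LD' δ : ℝ) : Prop :=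
  η < 1 ∧
    max (d * perturbation ε η LE LE' LD LD' *
        (LE * LD + perturbation ε η LE LE' LD LD') ^ (d - 1))
      (detLip d LE LE' LD LD' * ε) < δ

end

/-!
The differentials `x ↦ d(E_i ∘ ι)_x : T_x M → ℝᵈ` of the encoders are, over `U i`, continuous
fibrewise linear isomorphisms: `D_i ∘ E_i` is infinitesimally `η`-close to the identity along `M`
with `η < 1`, so `dE_i` is injective on `T_x M`, and the dimensions agree
(`ApproxAtlas.bijective_tangentEnc`). They are therefore coordinates on `T M`, with genuine
transition maps `h_{ji}(x)`, `h_{ji}(x) ∘ dE_i = dE_j` on `T_x M`.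

The matrix `g_{ji}(x) = d(E_j ∘ D_i)` differs from `h_{ji}(x)` in two respects: `D_i ∘ E_i` is not
quite the identity on `T_x M`, and `dE_j` is taken at `D_i (E_i x)` instead of `x`. Together these
errors are at most `(L_E η + L_E' ε) L_D / (1 - η)` (`norm_sub_comp_le`), which is at most `Γ`
(`perturbation_ge`). By Hadamard's inequality the determinants differ by at most
`d Γ (L_E L_D + Γ)^(d-1)` (`abs_det_sub_det_le`), which the stability condition makes smaller than
`|det g_{ji}(x)|`. Hence `ω_{ji}(x) = sign (det h_{ji}(x))` (`ApproxAtlas.sign_det_eq_sgn`).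

So `ω` is the orientation cocycle of `T M` in the encoder coordinates, and `T M` is orientable if
and only if it is a coboundary (`isOrientableBundle_iff_sign_coboundary`). Given an orientation,
connectedness of `U i` makes the coordinates over `U i` preserve it everywhere or reverse it
everywhere, which defines `ν i`. Conversely, given `ν`, the linear trivializations in which every
`ν i • det (dE_i)` is positive form an oriented atlas; they exist near each point because a
trivialization may be composed with a reflection of the fibre.
-/

/-! ### Perturbation of determinants -/

/-- Hadamard's inequality gives the Lipschitz bound for the determinant, which is multilinear in
the images of an orthonormal basis. -/
theorem abs_det_sub_det_le {d : ℕ} (A B : Euc d →L[ℝ] Euc d) :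
    |A.det - B.det| ≤ d * max ‖A‖ ‖B‖ ^ (d - 1) * ‖A - B‖ := by
  set b := EuclideanSpace.basisFun (Fin d) ℝ with hb
  have : Fact (Module.finrank ℝ (Euc d) = d) := ⟨by simp⟩
  have hdet (T : Euc d →L[ℝ] Euc d) : T.det = b.toBasis.det (fun i => T (b i)) := by
    have h := b.toBasis.det_comp T.toLinearMap b.toBasis
    rw [Module.Basis.det_self, mul_one] at h
    rw [ContinuousLinearMap.det, ← h]
    rfl
  have hadamard (m : Fin d → Euc d) :
      ‖b.toBasis.det.toMultilinearMap m‖ ≤ 1 * ∏ i, ‖m i‖ := by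
    have h := b.toBasis.orientation.abs_volumeForm_apply_le m
    rw [b.toBasis.orientation.volumeForm_robust' b] at h
    simpa using h
  have hcol (T : Euc d →L[ℝ] Euc d) : ‖fun i => T (b i)‖ ≤ ‖T‖ := by
    refine (pi_norm_le_iff_of_nonneg (norm_nonneg T)).2 fun i => ?_
    simpa [b.norm_eq_one] using T.le_opNorm (b i)
  have key := b.toBasis.det.toMultilinearMap.norm_image_sub_le_of_bound zero_le_one hadamard
    (fun i => A (b i)) (fun i => B (b i))
  rw [hdet A, hdet B]
  refine key.trans ?_
  have hsub : ‖(fun i => A (b i)) - fun i => B (b i)‖ ≤ ‖A - B‖ := hcol (A - B)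
  rw [Fintype.card_fin, one_mul]
  gcongr
  · exact hcol A
  · exact hcol B

theorem sign_eq_of_abs_sub_lt {a b : ℝ} (h : |a - b| < |b|) : Real.sign a = Real.sign b := by
  rcases lt_trichotomy b 0 with hb | rfl | hb
  · rw [abs_of_neg hb, abs_lt] at h
    rw [Real.sign_of_neg hb, Real.sign_of_neg (by linarith)]
  · simp at h
    exact absurd h (not_lt.2 (abs_nonneg a))
  · rw [abs_of_pos hb, abs_lt] at h
    rw [Real.sign_of_pos hb, Real.sign_of_pos (by linarith)]

theorem det_eq_one_of_dim_zero {k : ℕ} (hk : k = 0) (f : Euc k →ₗ[ℝ] Euc k) :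
    LinearMap.det f = 1 :=
  LinearMap.det_eq_one_of_finrank_eq_zero (by simp [hk]) f

/-- In positive dimension there is an orientation-reversing linear automorphism. -/
theorem exists_det_eq_neg_one {k : ℕ} (hk : k ≠ 0) :
    ∃ T : Euc k ≃L[ℝ] Euc k, LinearMap.det (T : Euc k →ₗ[ℝ] Euc k) = -1 := by
  have : NeZero k := ⟨hk⟩
  have hv : EuclideanSpace.single (0 : Fin k) (1 : ℝ) ≠ 0 := by simp
  refine ⟨(Submodule.reflection
    (ℝ ∙ EuclideanSpace.single (0 : Fin k) (1 : ℝ))ᗮ).toContinuousLinearEquiv, ?_⟩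
  have h := Submodule.det_reflection (ℝ ∙ EuclideanSpace.single (0 : Fin k) (1 : ℝ))ᗮ
  rw [Submodule.orthogonal_orthogonal, finrank_span_singleton hv, pow_one] at h
  exact h

/-- With `q = η / (1 - η)` one has `η (1 + q) = q ≤ η_eff`, so `Γ` dominates the left-hand side term
by term. -/
theorem perturbation_ge {ε η LE LE' LD LD' : ℝ} (hε : 0 ≤ ε) (hη : 0 ≤ η) (hη1 : η < 1)
    (hLE : 0 ≤ LE) (hLE' : 0 ≤ LE') (hLD : 0 ≤ LD) (hLD' : 0 ≤ LD') :
    (LE * η + LE' * ε) * (LD / (1 - η)) ≤ perturbation ε η LE LE' LD LD' := by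
  have h1 : 0 < 1 - η := by linarith
  set q := η / (1 - η) with hq
  have hq0 : 0 ≤ q := by positivity
  have hinv : LD / (1 - η) = LD * (1 + q) := by rw [hq]; field_simp; ring
  have hηq : η * (1 + q) = q := by rw [hq]; field_simp; ring
  have hle : q ≤ etaEff ε η LE LE' LD LD' := by
    have h2 : etaEff ε η LE LE' LD LD' = (LE * LD + 2) * q + (LD' * LE ^ 2 + LD * LE') * ε := by
      rw [etaEff, reconLip, hq, mul_div_assoc]
    have h3 : 0 ≤ LE * LD * q := by positivity
    have h4 : 0 ≤ (LD' * LE ^ 2 + LD * LE') * ε := by positivity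
    rw [h2]; nlinarith
  set e := etaEff ε η LE LE' LD LD'
  have he : 0 ≤ e := hq0.trans hle
  have hone : ε ≤ (LE * LD + 2) * ε := by
    have : 0 ≤ LE * LD * ε := by positivity
    nlinarith
  calc (LE * η + LE' * ε) * (LD / (1 - η))
      = LE * (η * (1 + q)) * LD + LE' * ε * (1 + q) * LD := by rw [hinv]; ring
    _ = LE * q * LD + LE' * ε * (1 + q) * LD := by rw [hηq]
    _ ≤ LE * e * LD + LE' * ((LE * LD + 2) * ε) * (1 + e) * LD := by gcongr
    _ = perturbation ε η LE LE' LD LD' := rfl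

/-- If `G` nearly inverts `P` on `W`, then the map `h` given by `P w ↦ Q w` is close to
`Q' ∘ G`. -/
theorem norm_sub_comp_le {E F H : Type*} [NormedAddCommGroup E] [NormedSpace ℝ E]
    [NormedAddCommGroup F] [NormedSpace ℝ F] [NormedAddCommGroup H] [NormedSpace ℝ H]
    {W : Submodule ℝ E}
    {P : E →L[ℝ] F} {G : F →L[ℝ] E} {Q Q' : E →L[ℝ] H} {h : F →L[ℝ] H} {η a b c : ℝ}
    (hη : 0 ≤ η) (hη1 : η < 1) (hsurj : ∀ y, ∃ w ∈ W, P w = y)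
    (hGP : ∀ w ∈ W, ‖G (P w) - w‖ ≤ η * ‖w‖) (hh : ∀ w ∈ W, h (P w) = Q w)
    (hG : ‖G‖ ≤ b) (hQ' : ‖Q'‖ ≤ a) (hQ : ‖Q - Q'‖ ≤ c) :
    ‖h - Q' ∘L G‖ ≤ (a * η + c) * (b / (1 - η)) := by
  have h1 : 0 < 1 - η := by linarith
  have ha : 0 ≤ a := (norm_nonneg _).trans hQ'
  have hb : 0 ≤ b := (norm_nonneg _).trans hG
  have hc : 0 ≤ c := (norm_nonneg _).trans hQ
  refine ContinuousLinearMap.opNorm_le_bound _ (by positivity) fun y => ?_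
  obtain ⟨w, hw, rfl⟩ := hsurj y
  -- a lower bound for `P` on `W`
  have hPw : ‖w‖ ≤ b / (1 - η) * ‖P w‖ := by
    have h2 : ‖w‖ ≤ ‖G (P w)‖ + ‖G (P w) - w‖ := by
      simpa using norm_sub_le (G (P w)) (G (P w) - w)
    have h3 := (G.le_opNorm (P w)).trans (mul_le_mul_of_nonneg_right hG (norm_nonneg _))
    have h4 := hGP w hw
    rw [div_mul_eq_mul_div, le_div_iff₀ h1]
    nlinarith
  have hsplit : (h - Q' ∘L G) (P w) = (Q - Q') w - Q' (G (P w) - w) := by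
    simp [hh w hw]
  rw [hsplit]
  calc ‖(Q - Q') w - Q' (G (P w) - w)‖ ≤ ‖(Q - Q') w‖ + ‖Q' (G (P w) - w)‖ := norm_sub_le _ _
    _ ≤ c * ‖w‖ + a * (η * ‖w‖) := by
        refine add_le_add ((Q - Q').le_of_opNorm_le hQ w) ?_
        exact (Q'.le_of_opNorm_le hQ' _).trans (by gcongr; exact hGP w hw)
    _ = (a * η + c) * ‖w‖ := by ring
    _ ≤ (a * η + c) * (b / (1 - η) * ‖P w‖) := by gcongr
    _ = _ := by ring

theorem sign_det_eq_of_norm_sub_le {d : ℕ} {g h : Euc d →L[ℝ] Euc d} {c Γ : ℝ}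
    (hg : ‖g‖ ≤ c) (hgh : ‖h - g‖ ≤ Γ) (hdet : d * Γ * (c + Γ) ^ (d - 1) < |g.det|) :
    Real.sign h.det = Real.sign g.det := by
  have hΓ : 0 ≤ Γ := (norm_nonneg _).trans hgh
  have hh : ‖h‖ ≤ c + Γ := by
    have := norm_add_le g (h - g)
    rw [add_sub_cancel] at this
    linarith
  refine sign_eq_of_abs_sub_lt ((abs_det_sub_det_le h g).trans_lt (lt_of_le_of_lt ?_ hdet))
  have hc0 : 0 ≤ c + Γ := (norm_nonneg h).trans hh
  have hmax : max ‖h‖ ‖g‖ ≤ c + Γ := max_le hh (by linarith)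
  calc (d : ℝ) * max ‖h‖ ‖g‖ ^ (d - 1) * ‖h - g‖ ≤ d * (c + Γ) ^ (d - 1) * Γ := by
        gcongr
    _ = _ := by ring

/-! ### Orientability of a vector bundle with given local frames -/

theorem exists_comp_eq_of_bijective {k : ℕ} {W : Type*} [AddCommGroup W] [Module ℝ W]
    {f : W →ₗ[ℝ] Euc k} (hf : Function.Bijective f) (g : W →ₗ[ℝ] Euc k) :
    ∃ h : Euc k →ₗ[ℝ] Euc k, h ∘ₗ f = g := by
  refine ⟨g ∘ₗ (LinearEquiv.ofBijective f hf).symm.toLinearMap, ?_⟩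
  ext1 v
  have : (LinearEquiv.ofBijective f hf).symm (f v) = v :=
    (LinearEquiv.ofBijective f hf).symm_apply_apply v
  simp [this]

theorem sign_eq_mul_of_pos {a b c s t : ℝ} (hs : s = 1 ∨ s = -1) (ht : t = 1 ∨ t = -1)
    (hb : 0 < s * b) (ha : 0 < t * a) (hab : a = c * b) : Real.sign c = t * s := by
  rcases hs with rfl | rfl <;> rcases ht with rfl | rfl <;>
    simp only [one_mul, neg_mul, neg_pos, mul_one, mul_neg, neg_neg] at ha hb ⊢
  · exact Real.sign_of_pos (pos_of_mul_pos_left (hab ▸ ha) hb.le)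
  · exact Real.sign_of_neg (neg_of_mul_neg_left (hab ▸ ha) hb.le)
  · exact Real.sign_of_neg (by nlinarith)
  · exact Real.sign_of_pos (by nlinarith)

theorem pos_of_sign_eq_mul {a b c s t : ℝ} (hs : s = 1 ∨ s = -1) (ht : t = 1 ∨ t = -1)
    (hb : 0 < s * b) (hc : Real.sign c = t * s) (hab : a = c * b) : 0 < t * a := by
  have hc' : Real.sign c * c = |c| := by
    rcases lt_trichotomy c 0 with h | rfl | h
    · rw [Real.sign_of_neg h, abs_of_neg h, neg_one_mul]
    · simp
    · rw [Real.sign_of_pos h, abs_of_pos h, one_mul]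
  have hc0 : c ≠ 0 := by
    rintro rfl
    rcases hs with rfl | rfl <;> rcases ht with rfl | rfl <;> simp at hc
  have ht2 : s * s = 1 := by rcases hs with rfl | rfl <;> norm_num
  have : t * a = |c| * (s * b) := by
    rw [hab, ← hc', hc]
    linear_combination (-(t * c * b)) * ht2
  rw [this]
  exact mul_pos (abs_pos.2 hc0) hb

section Bundle

variable {k : ℕ} {B : Type*} [TopologicalSpace B] {V : B → Type*}
    [∀ b, AddCommGroup (V b)] [∀ b, Module ℝ (V b)]
    [TopologicalSpace (TotalSpace (Euc k) V)]

/-- The determinant of the fibrewise linear map `φ` to `ℝᵏ`, read in the linear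
trivialization `e`. Meaningful over the base set of `e`. -/
noncomputable def trivDet (φ : ∀ b, V b →ₗ[ℝ] Euc k) (e : Trivialization (Euc k) (π (Euc k) V))
    [e.IsLinear ℝ] (b : B) : ℝ :=
  LinearMap.det (φ b ∘ₗ e.symmₗ ℝ b)

/-- A general linear trivialization is only known to be continuous on the total space; in finite
dimension this already makes the determinant depend continuously on the base point. -/
theorem continuousOn_trivDet {φ : ∀ b, V b →ₗ[ℝ] Euc k} {U : Set B}
    (hφ : ContinuousOn (fun p : TotalSpace (Euc k) V => φ p.1 p.2) (π (Euc k) V ⁻¹' U))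
    (e : Trivialization (Euc k) (π (Euc k) V)) [e.IsLinear ℝ] :
    ContinuousOn (trivDet φ e) (U ∩ e.baseSet) := by
  have h : ContinuousOn
      (fun b => LinearMap.toContinuousLinearMap (φ b ∘ₗ e.symmₗ ℝ b)) (U ∩ e.baseSet) := by
    refine continuousOn_clm_apply.2 fun y => ?_
    have h1 : ContinuousOn (fun b => TotalSpace.mk' (Euc k) b (e.symm b y)) (U ∩ e.baseSet) :=
      e.continuousOn_symm.comp (f := fun b => (b, y)) (by fun_prop)
        fun b hb => ⟨hb.2, Set.mem_univ _⟩
    refine (hφ.comp h1 fun b hb => hb.1).congr fun b hb => ?_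
    simp [e.symmₗ_apply hb.2]
  exact ContinuousLinearMap.continuous_det.comp_continuousOn h

theorem trivDet_eq_mul_coordChange (φ : ∀ b, V b →ₗ[ℝ] Euc k)
    (e e' : Trivialization (Euc k) (π (Euc k) V)) [e.IsLinear ℝ] [e'.IsLinear ℝ] {b : B}
    (hb : b ∈ e.baseSet ∩ e'.baseSet) :
    trivDet φ e b
      = trivDet φ e' b * LinearMap.det (e.coordChangeL ℝ e' b : Euc k →ₗ[ℝ] Euc k) := by
  rw [trivDet, trivDet, ← LinearMap.det_comp]
  congr 1
  ext1 y
  simp only [LinearMap.comp_apply, LinearEquiv.coe_coe,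
    ContinuousLinearEquiv.coe_toLinearEquiv]
  rw [e.symmₗ_apply hb.1, e'.symmₗ_apply hb.2, e.coordChangeL_apply e' hb,
    e'.symm_apply_apply_mk hb.2]

theorem trivDet_transition {φ ψ : ∀ b, V b →ₗ[ℝ] Euc k} {b : B} {h : Euc k →ₗ[ℝ] Euc k}
    (hh : h ∘ₗ φ b = ψ b) (e : Trivialization (Euc k) (π (Euc k) V)) [e.IsLinear ℝ] :
    trivDet ψ e b = LinearMap.det h * trivDet φ e b := by
  rw [trivDet, trivDet, ← LinearMap.det_comp, ← hh, LinearMap.comp_assoc]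

theorem trivDet_ne_zero {φ : ∀ b, V b →ₗ[ℝ] Euc k}
    (e : Trivialization (Euc k) (π (Euc k) V)) [e.IsLinear ℝ] {b : B} (hb : b ∈ e.baseSet)
    (hφ : Function.Bijective (φ b)) : trivDet φ e b ≠ 0 := by
  have h : trivDet φ e b = LinearMap.det
      (((e.linearEquivAt ℝ b hb).symm.trans (LinearEquiv.ofBijective (φ b) hφ) :
        Euc k ≃ₗ[ℝ] Euc k) : Euc k →ₗ[ℝ] Euc k) := by
    rw [trivDet]
    congr 1
    ext1 y
    simp [e.symmₗ_apply hb]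
  rw [h]
  exact (LinearEquiv.isUnit_det' _).ne_zero

/-- A linear trivialization can be restricted to an open set and followed by a linear
automorphism of the fibre. -/
theorem exists_trivDet_eq_mul (e : Trivialization (Euc k) (π (Euc k) V)) [e.IsLinear ℝ]
    {s : Set B} (hs : IsOpen s) (T : Euc k ≃L[ℝ] Euc k) :
    ∃ (e' : Trivialization (Euc k) (π (Euc k) V)) (_ : e'.IsLinear ℝ),
      e'.baseSet = e.baseSet ∩ s ∧ ∀ (φ : ∀ b, V b →ₗ[ℝ] Euc k), ∀ b ∈ e'.baseSet,
        trivDet φ e' b = trivDet φ e b * LinearMap.det (T.symm : Euc k →ₗ[ℝ] Euc k) := by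
  let e' : Trivialization (Euc k) (π (Euc k) V) :=
    (e.restrOpen s hs).transFiberHomeomorph T.toHomeomorph
  have happ (p : TotalSpace (Euc k) V) : e' p = ((e p).1, T (e p).2) := rfl
  have hlin : e'.IsLinear ℝ := ⟨fun b hb => by
    have h := Trivialization.IsLinear.linear (R := ℝ) (e := e) b hb.1
    refine ⟨fun x y => ?_, fun c x => ?_⟩
    · simp only [happ]
      rw [h.map_add, map_add]
    · simp only [happ]
      rw [h.map_smul, map_smul]⟩
  refine ⟨e', hlin, rfl, fun φ b hb => ?_⟩
  rw [trivDet, trivDet, ← LinearMap.det_comp]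
  congr 1
  ext1 y
  simp only [LinearMap.comp_apply]
  have hsymm : e'.symm b y = e.symm b (T.symm y) := by
    have h1 : e' ⟨b, e.symm b (T.symm y)⟩ = (b, y) := by
      rw [happ, e.apply_mk_symm hb.1]; simp
    have h2 := e'.symm_apply_apply_mk hb (e.symm b (T.symm y))
    rw [h1] at h2
    exact h2
  rw [e'.symmₗ_apply hb, hsymm, e.symmₗ_apply hb.1]
  rfl

variable {I : Type*} {U : I → Set B} {φ : I → ∀ b, V b →ₗ[ℝ] Euc k} {σ : I → I → B → ℝ}

/-- Fibrewise isomorphisms `φ i` over connected sets `U i` have constant orientation character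
with respect to an orientation of the bundle. -/
theorem exists_sign_of_isOriented (hU : ∀ i, IsOpen (U i))
    (hconn : ∀ i, IsPreconnected (U i))
    (hcont : ∀ i, ContinuousOn (fun p : TotalSpace (Euc k) V => φ i p.1 p.2)
      (π (Euc k) V ⁻¹' U i))
    (hbij : ∀ i, ∀ b ∈ U i, Function.Bijective (φ i b))
    {S : Set (Trivialization (Euc k) (π (Euc k) V))}
    (hlin : ∀ e ∈ S, e.IsLinear ℝ) (hcov : ∀ b : B, ∃ e ∈ S, b ∈ e.baseSet)
    (hpos : ∀ (e e' : Trivialization (Euc k) (π (Euc k) V)) [e.IsLinear ℝ] [e'.IsLinear ℝ],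
      e ∈ S → e' ∈ S → ∀ b ∈ e.baseSet ∩ e'.baseSet,
        0 < LinearMap.det (e.coordChangeL ℝ e' b : Euc k →ₗ[ℝ] Euc k)) (i : I) :
    ∃ ν : ℝ, (ν = 1 ∨ ν = -1) ∧ ∀ e ∈ S, ∀ [e.IsLinear ℝ], ∀ b ∈ U i ∩ e.baseSet,
      0 < ν * trivDet (φ i) e b := by
  -- the two open sets on which `φ i` preserves, respectively reverses, the orientation
  let P (s : Set ℝ) : Set B := ⋃ (e : Trivialization (Euc k) (π (Euc k) V)) (he : e ∈ S),
    (U i ∩ e.baseSet) ∩ (haveI := hlin e he; trivDet (φ i) e) ⁻¹' s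
  have hPopen (s : Set ℝ) (hs : IsOpen s) : IsOpen (P s) := by
    refine isOpen_iUnion fun e => isOpen_iUnion fun he => ?_
    have := hlin e he
    exact (continuousOn_trivDet (hcont i) e).isOpen_inter_preimage
      ((hU i).inter e.open_baseSet) hs
  have hsame : ∀ e ∈ S, ∀ e' ∈ S, ∀ [e.IsLinear ℝ] [e'.IsLinear ℝ],
      ∀ b ∈ e.baseSet ∩ e'.baseSet, ∃ c > 0, trivDet (φ i) e b = trivDet (φ i) e' b * c :=
    fun e he e' he' _ _ b hb =>
      ⟨_, hpos e e' he he' b hb, trivDet_eq_mul_coordChange (φ i) e e' hb⟩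
  have hcover : U i ⊆ P (Set.Ioi 0) ∪ P (Set.Iio 0) := by
    intro b hb
    obtain ⟨e, he, hbe⟩ := hcov b
    have := hlin e he
    rcases lt_or_gt_of_ne (trivDet_ne_zero e hbe (hbij i b hb)) with h | h
    · exact Or.inr (Set.mem_iUnion₂.2 ⟨e, he, ⟨hb, hbe⟩, h⟩)
    · exact Or.inl (Set.mem_iUnion₂.2 ⟨e, he, ⟨hb, hbe⟩, h⟩)
  have hdisj : Disjoint (P (Set.Ioi 0)) (P (Set.Iio 0)) := by
    refine Set.disjoint_left.2 fun b hb hb' => ?_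
    obtain ⟨e, he, ⟨_, hbe⟩, h⟩ := Set.mem_iUnion₂.1 hb
    obtain ⟨e', he', ⟨_, hbe'⟩, h'⟩ := Set.mem_iUnion₂.1 hb'
    have := hlin e he
    have := hlin e' he'
    obtain ⟨c, hc, heq⟩ := hsame e he e' he' b ⟨hbe, hbe'⟩
    rw [Set.mem_preimage, Set.mem_Ioi] at h
    rw [Set.mem_preimage, Set.mem_Iio] at h'
    nlinarith
  rcases (hconn i).subset_or_subset (hPopen _ isOpen_Ioi) (hPopen _ isOpen_Iio) hdisj hcover
    with hsub | hsub
  · refine ⟨1, Or.inl rfl, fun e he _ b hb => ?_⟩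
    obtain ⟨e', he', ⟨_, hbe'⟩, h'⟩ := Set.mem_iUnion₂.1 (hsub hb.1)
    have := hlin e' he'
    obtain ⟨c, hc, heq⟩ := hsame e he e' he' b ⟨hb.2, hbe'⟩
    rw [Set.mem_preimage, Set.mem_Ioi] at h'
    rw [heq, one_mul]
    exact mul_pos h' hc
  · refine ⟨-1, Or.inr rfl, fun e he _ b hb => ?_⟩
    obtain ⟨e', he', ⟨_, hbe'⟩, h'⟩ := Set.mem_iUnion₂.1 (hsub hb.1)
    have := hlin e' he'
    obtain ⟨c, hc, heq⟩ := hsame e he e' he' b ⟨hb.2, hbe'⟩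
    rw [Set.mem_preimage, Set.mem_Iio] at h'
    rw [heq]
    nlinarith

/-- First Stiefel–Whitney class criterion: the bundle is orientable if and only if the cocycle of
signs of the transition maps `φ j ∘ (φ i)⁻¹` is a coboundary. -/
theorem isOrientableBundle_iff_sign_coboundary [∀ b, TopologicalSpace (V b)]
    [FiberBundle (Euc k) V] [VectorBundle ℝ (Euc k) V]
    (hU : ∀ i, IsOpen (U i)) (hcov : ⋃ i, U i = Set.univ)
    (hconn : ∀ i, IsPreconnected (U i))
    (hcont : ∀ i, ContinuousOn (fun p : TotalSpace (Euc k) V => φ i p.1 p.2)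
      (π (Euc k) V ⁻¹' U i))
    (hbij : ∀ i, ∀ b ∈ U i, Function.Bijective (φ i b))
    (hσ : ∀ i j, ∀ b ∈ U i ∩ U j, ∀ h : Euc k →ₗ[ℝ] Euc k, h ∘ₗ φ i b = φ j b →
      Real.sign (LinearMap.det h) = σ j i b) :
    IsOrientableBundle k V ↔ ∃ ν : I → ℝ, (∀ i, ν i = 1 ∨ ν i = -1) ∧
      ∀ i j, ∀ b ∈ U i ∩ U j, σ j i b = ν j * ν i := by
  constructor
  · rintro ⟨S, hlin, hScov, hpos⟩
    choose ν hν hνpos using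
      exists_sign_of_isOriented hU hconn hcont hbij hlin hScov hpos
    refine ⟨ν, hν, fun i j b hb => ?_⟩
    obtain ⟨h, hh⟩ := exists_comp_eq_of_bijective (hbij i b hb.1) (φ j b)
    obtain ⟨e, he, hbe⟩ := hScov b
    have := hlin e he
    rw [← hσ i j b hb h hh]
    exact sign_eq_mul_of_pos (hν i) (hν j) (hνpos i e he b ⟨hb.1, hbe⟩)
      (hνpos j e he b ⟨hb.2, hbe⟩) (trivDet_transition hh e)
  · rintro ⟨ν, hν, hνσ⟩
    -- in rank `0` there is no reflection to adjust signs with, but all determinants are `1`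
    rcases eq_or_ne k 0 with hk | hk
    · refine ⟨{e | e.IsLinear ℝ}, fun e he => he, fun b => ⟨trivializationAt (Euc k) V b,
        inferInstanceAs ((trivializationAt (Euc k) V b).IsLinear ℝ),
        FiberBundle.mem_baseSet_trivializationAt' b⟩, fun e e' _ _ _ _ b _ => ?_⟩
      rw [det_eq_one_of_dim_zero hk]
      exact one_pos
    -- the linear trivializations which all the `ν i • φ i` orient positively
    refine ⟨{e | ∃ _ : e.IsLinear ℝ, ∀ i, ∀ b ∈ U i ∩ e.baseSet, 0 < ν i * trivDet (φ i) e b},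
      fun e he => he.1, fun b₀ => ?_, fun e e' _ _ he he' b hb => ?_⟩
    · obtain ⟨i, hi⟩ := Set.mem_iUnion.1 (hcov.symm ▸ Set.mem_univ b₀)
      set e := trivializationAt (Euc k) V b₀ with he
      have hb₀ : b₀ ∈ e.baseSet := FiberBundle.mem_baseSet_trivializationAt' b₀
      have hD : ν i * trivDet (φ i) e b₀ ≠ 0 :=
        mul_ne_zero (by rcases hν i with h | h <;> rw [h] <;> norm_num)
          (trivDet_ne_zero e hb₀ (hbij i b₀ hi))
      obtain ⟨T, hT⟩ : ∃ T : Euc k ≃L[ℝ] Euc k,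
          0 < ν i * trivDet (φ i) e b₀ * LinearMap.det (T.symm : Euc k →ₗ[ℝ] Euc k) := by
        rcases lt_or_gt_of_ne hD with hneg | hpos
        · obtain ⟨T, hT⟩ := exists_det_eq_neg_one hk
          refine ⟨T.symm, ?_⟩
          rw [ContinuousLinearEquiv.symm_symm, hT]
          linarith
        · refine ⟨ContinuousLinearEquiv.refl ℝ _, ?_⟩
          have : LinearMap.det (((ContinuousLinearEquiv.refl ℝ (Euc k)).symm : Euc k ≃L[ℝ] Euc k) :
              Euc k →ₗ[ℝ] Euc k) = 1 := LinearMap.det_id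
          rw [this, mul_one]
          exact hpos
      set s : Set B := (U i ∩ e.baseSet) ∩ trivDet (φ i) e ⁻¹'
        {r | 0 < ν i * r * LinearMap.det (T.symm : Euc k →ₗ[ℝ] Euc k)} with hs_def
      have hs : IsOpen s := (continuousOn_trivDet (hcont i) e).isOpen_inter_preimage
        ((hU i).inter e.open_baseSet) (isOpen_lt continuous_const (by fun_prop))
      obtain ⟨e', he', hbase, hdet⟩ := exists_trivDet_eq_mul e hs T
      refine ⟨e', ⟨he', fun j b hb => ?_⟩, hbase ▸ ⟨hb₀, ⟨hi, hb₀⟩, hT⟩⟩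
      have hbs : b ∈ s := (hbase ▸ hb.2 : b ∈ e.baseSet ∩ s).2
      obtain ⟨h, hh⟩ := exists_comp_eq_of_bijective (hbij i b hbs.1.1) (φ j b)
      have hbi : 0 < ν i * trivDet (φ i) e' b := by
        rw [hdet (φ i) b hb.2, ← mul_assoc]
        exact hbs.2
      exact pos_of_sign_eq_mul (hν i) (hν j) hbi
        ((hσ i j b ⟨hbs.1.1, hb.1⟩ h hh).trans (hνσ i j b ⟨hbs.1.1, hb.1⟩))
        (trivDet_transition hh e')
    · obtain ⟨_, he⟩ := he
      obtain ⟨_, he'⟩ := he'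
      obtain ⟨i, hi⟩ := Set.mem_iUnion.1 (hcov.symm ▸ Set.mem_univ b)
      have h1 := he i b ⟨hi, hb.1⟩
      rw [trivDet_eq_mul_coordChange (φ i) e e' hb, ← mul_assoc] at h1
      exact pos_of_mul_pos_right h1 (he' i b ⟨hi, hb.2⟩).le

end Bundle

/-! ### Immersions and encoders on the tangent bundle -/

/-- An immersion is linear in suitable charts, hence has a smooth local left inverse, and its
differential is injective by the chain rule. -/
theorem injective_mfderiv_of_isImmersionAt {E E' H H' M M' : Type*}
    [NormedAddCommGroup E] [NormedSpace ℝ E] [NormedAddCommGroup E'] [NormedSpace ℝ E']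
    [TopologicalSpace H] [TopologicalSpace H'] [TopologicalSpace M] [TopologicalSpace M']
    {I : ModelWithCorners ℝ E H} {J : ModelWithCorners ℝ E' H'} [I.Boundaryless]
    [ChartedSpace H M] [ChartedSpace H' M'] [IsManifold I ∞ M] [IsManifold J ∞ M']
    {f : M → M'} {x : M} (h : Manifold.IsImmersionAt I J ∞ f x) :
    Function.Injective (mfderiv I J f x) := by
  have hx : x ∈ h.domChart.source := h.mem_domChart_source
  have hone : (∞ : WithTop ℕ∞) ≠ 0 := by simp
  set lin : E' →L[ℝ] E := ContinuousLinearMap.fst ℝ E h.complement ∘L h.equiv.symm with hlin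
  have hw (y : M) (hy : y ∈ h.domChart.source) :
      lin (h.codChart.extend J (f y)) = h.domChart.extend I y := by
    have h1 := h.writtenInCharts ((h.domChart.extend I).map_source (by simpa using hy))
    simp only [Function.comp_apply] at h1
    rw [(h.domChart.extend I).left_inv (by simpa using hy)] at h1
    rw [h1]
    simp [hlin]
  have hcod : MDifferentiableAt J 𝓘(ℝ, E') (h.codChart.extend J) (f x) :=
    (OpenPartialHomeomorph.contMDiffAt_extend h.codChart_mem_maximalAtlas
      h.mem_codChart_source).mdifferentiableAt hone
  have hf : MDifferentiableAt I J f x := h.contMDiffAt.mdifferentiableAt hone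
  have hsymm : MDifferentiableAt 𝓘(ℝ, E) I (h.domChart.extend I).symm
      (h.domChart.extend I x) := by
    refine ((contMDiffOn_extend_symm h.domChart_mem_maximalAtlas).contMDiffAt
      (IsOpen.mem_nhds ?_ ?_)).mdifferentiableAt hone
    · exact I.toHomeomorph.isOpenMap _ h.domChart.open_target
    · exact ⟨_, h.domChart.map_source hx, rfl⟩
  have hg : MDifferentiableAt J I
      ((h.domChart.extend I).symm ∘ (lin ∘ h.codChart.extend J)) (f x) := by
    refine MDifferentiableAt.comp (I' := 𝓘(ℝ, E)) _ ?_
      (lin.differentiableAt.mdifferentiableAt.comp _ hcod)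
    rw [Function.comp_apply, hw x hx]
    exact hsymm
  have hid : ((h.domChart.extend I).symm ∘ (lin ∘ h.codChart.extend J)) ∘ f =ᶠ[nhds x] id := by
    filter_upwards [h.domChart.open_source.mem_nhds hx] with y hy
    simp only [Function.comp_apply, hw y hy]
    exact (h.domChart.extend I).left_inv (by simpa using hy)
  have hcomp := mfderiv_comp x hg hf
  rw [hid.mfderiv_eq, mfderiv_id] at hcomp
  exact Function.LeftInverse.injective fun v => (DFunLike.congr_fun hcomp v).symm

theorem ContMDiff.continuous_mfderiv_apply {E E' H M : Type*}
    [NormedAddCommGroup E] [NormedSpace ℝ E] [NormedAddCommGroup E'] [NormedSpace ℝ E']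
    [TopologicalSpace H] [TopologicalSpace M] {I : ModelWithCorners ℝ E H}
    [ChartedSpace H M] [IsManifold I 1 M] {f : M → E'} (hf : ContMDiff I 𝓘(ℝ, E') 1 f) :
    Continuous fun p : TangentBundle I M => (mfderiv I 𝓘(ℝ, E') f p.1 p.2 : E') := by
  have h1 := hf.continuous_tangentMap le_rfl
  have h2 := (tangentBundleModelSpaceHomeomorph 𝓘(ℝ, E')).continuous.comp h1
  exact continuous_snd.comp h2

theorem exists_ne_of_fderiv_ne_zero {E F : Type*} [NormedAddCommGroup E] [NormedSpace ℝ E]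
    [NormedAddCommGroup F] [NormedSpace ℝ F] {f : E → F} {s : Set E} (hs : IsOpen s) {p : E}
    (hp : p ∈ s) (hf : fderiv ℝ f p ≠ 0) : ∃ q ∈ s, f q ≠ f p := by
  by_contra! h
  have : f =ᶠ[nhds p] fun _ => f p := by
    filter_upwards [hs.mem_nhds hp] with q hq using h q hq
  exact hf (by rw [this.fderiv_eq]; simp)

theorem nonneg_of_norm_le_mul_norm_sub {E F : Type*} [NormedAddCommGroup E]
    [NormedAddCommGroup F] {L : ℝ} {a : F} {p q : E} (hpq : q ≠ p) (h : ‖a‖ ≤ L * ‖q - p‖) :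
    0 ≤ L :=
  nonneg_of_mul_nonneg_left ((norm_nonneg a).trans h) (norm_pos_iff.2 (sub_ne_zero.2 hpq))

namespace ApproxAtlas

variable {d N : ℕ} {M : Type*} [TopologicalSpace M] [ChartedSpace (Euc d) M]
  {ι : M → Euc N} {I : Type*} {U : I → Set M} {ε η : ℝ}

/-- The differential of the encoder `E_i ∘ ι` along the manifold, `T_x M → ℝᵈ`. -/
noncomputable def tangentEnc (A : ApproxAtlas d ι U ε η) (i : I) (x : M) :
    TangentSpace (𝓡 d) x →L[ℝ] Euc d :=
  fderiv ℝ (A.enc i) (ι x) ∘L mdiff d ι x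

theorem continuousOn_tangentEnc [IsManifold (𝓡 d) 1 M] (A : ApproxAtlas d ι U ε η)
    (hι : ContMDiff (𝓡 d) 𝓘(ℝ, Euc N) 1 ι) (i : I) :
    ContinuousOn (fun p : TangentBundle (𝓡 d) M => A.tangentEnc i p.1 p.2)
      (π (Euc d) (TangentSpace (𝓡 d) (M := M)) ⁻¹' U i) := by
  have h1 : ContinuousOn (fun p : TangentBundle (𝓡 d) M => fderiv ℝ (A.enc i) (ι p.1))
      (π (Euc d) (TangentSpace (𝓡 d) (M := M)) ⁻¹' U i) :=
    ((A.contDiffOn_enc i).continuousOn_fderiv_of_isOpen (A.isOpen_encDom i) le_rfl).comp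
      (hι.continuous.comp (FiberBundle.continuous_proj _ _)).continuousOn
      fun p hp => A.subset_encDom i ⟨p.1, hp, rfl⟩
  exact h1.clm_apply hι.continuous_mfderiv_apply.continuousOn

variable (A : ApproxAtlas d ι U ε η) {i j : I} {x : M}

theorem enc_differentiableAt {p : Euc N} (hp : p ∈ A.encDom i) :
    DifferentiableAt ℝ (A.enc i) p :=
  ((A.contDiffOn_enc i).contDiffAt ((A.isOpen_encDom i).mem_nhds hp)).differentiableAt (by simp)

theorem dec_differentiableAt (hx : x ∈ U i) :
    DifferentiableAt ℝ (A.dec i) (A.enc i (ι x)) :=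
  ((A.contDiffOn_dec i).contDiffAt ((A.isOpen_decDom i).mem_nhds
    (A.subset_decDom i ⟨_, ⟨x, hx, rfl⟩, rfl⟩))).differentiableAt (by simp)

theorem dec_enc_mem (hi : x ∈ U i) (hj : x ∈ U j) : A.dec i (A.enc i (ι x)) ∈ A.encDom j :=
  A.cthickening_subset j (Metric.mem_cthickening_of_dist_le _ (ι x) _ _ ⟨x, hj, rfl⟩
    (by rw [dist_eq_norm]; exact A.reconstruction i x hi))

theorem jac_eq_comp (hi : x ∈ U i) (hj : x ∈ U j) :
    A.jac j i x = fderiv ℝ (A.enc j) (A.dec i (A.enc i (ι x))) ∘L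
      fderiv ℝ (A.dec i) (A.enc i (ι x)) :=
  fderiv_comp _ (A.enc_differentiableAt (A.dec_enc_mem hi hj)) (A.dec_differentiableAt hi)

theorem norm_dec_enc_sub_le (hi : x ∈ U i) {w : Euc N} (hw : w ∈ embeddedTangentSpace d ι x) :
    ‖fderiv ℝ (A.dec i) (A.enc i (ι x)) (fderiv ℝ (A.enc i) (ι x) w) - w‖ ≤ η * ‖w‖ := by
  have h := A.differential_reconstruction i x hi w hw
  rwa [fderiv_comp _ (A.dec_differentiableAt hi)
    (A.enc_differentiableAt (A.subset_encDom i ⟨x, hi, rfl⟩))] at h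

/-- Since `D_i ∘ E_i` is infinitesimally `η`-close to the identity with `η < 1`, the encoder
induces linear coordinates on each tangent space. -/
theorem bijective_tangentEnc (hη : η < 1) (hinj : Function.Injective (mdiff d ι x))
    (hi : x ∈ U i) : Function.Bijective (A.tangentEnc i x) := by
  have h : Function.Injective (A.tangentEnc i x).toLinearMap := by
    refine (injective_iff_map_eq_zero _).2 fun v hv => hinj ?_
    have h1 := A.norm_dec_enc_sub_le hi (w := mdiff d ι x v) ⟨v, rfl⟩
    have h2 : fderiv ℝ (A.enc i) (ι x) (mdiff d ι x v) = 0 := hv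
    rw [h2, map_zero, zero_sub, norm_neg] at h1
    rw [map_zero, ← norm_eq_zero]
    nlinarith [norm_nonneg (mdiff d ι x v)]
  -- `T_x M` is the model space `ℝᵈ`, so injectivity suffices
  have hsurj (f : Euc d →ₗ[ℝ] Euc d) (hf : Function.Injective f) : Function.Surjective f :=
    LinearMap.injective_iff_surjective.1 hf
  exact ⟨h, hsurj (A.tangentEnc i x).toLinearMap h⟩

theorem gap_le_abs_det_jac (hi : x ∈ U i) (hj : x ∈ U j) : A.gap ≤ |(A.jac j i x).det| :=
  csInf_le ⟨0, by rintro r ⟨i, j, x, _, rfl⟩; exact abs_nonneg _⟩ ⟨i, j, x, ⟨hi, hj⟩, rfl⟩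

variable {A}

/-- The encoder–decoder transition differential `g_{ji}(x)` has the same orientation sign as the
change of coordinates `h` between the encoder coordinates `i` and `j` on `T_x M`. -/
theorem sign_det_eq_sgn {LE LE' LD LD' : ℝ} (hA : A.RegularityBounds LE LE' LD LD')
    (hst : StabilityCondition d ε η LE LE' LD LD' A.gap)
    (hinj : Function.Injective (mdiff d ι x)) (hx : x ∈ U i ∩ U j) {h : Euc d →ₗ[ℝ] Euc d}
    (hh : h ∘ₗ (A.tangentEnc i x).toLinearMap = (A.tangentEnc j x).toLinearMap) :
    Real.sign (LinearMap.det h) = A.sgn j i x := by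
  rcases eq_or_ne d 0 with hd | hd
  · rw [sgn, ContinuousLinearMap.det, det_eq_one_of_dim_zero hd, det_eq_one_of_dim_zero hd]
  obtain ⟨hi, hj⟩ := hx
  obtain ⟨hη1, hmax⟩ := hst
  have hbij := A.bijective_tangentEnc hη1 hinj hi
  have hmem {k : I} (hk : x ∈ U k) : ι x ∈ A.encDom k := A.subset_encDom k ⟨x, hk, rfl⟩
  have hε : 0 ≤ ε := (norm_nonneg _).trans (A.reconstruction i x hi)
  -- a nonzero tangent vector, whose existence makes the remaining constants nonnegative
  obtain ⟨v, hv⟩ : ∃ v : TangentSpace (𝓡 d) x, v ≠ 0 := by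
    have : NeZero d := ⟨hd⟩
    exact exists_ne (0 : Euc d)
  have hιv : mdiff d ι x v ≠ 0 := fun h0 => hv (hinj (h0.trans (map_zero _).symm))
  have hη : 0 ≤ η := nonneg_of_mul_nonneg_left
    ((norm_nonneg _).trans (A.norm_dec_enc_sub_le hi ⟨v, rfl⟩)) (norm_pos_iff.2 hιv)
  obtain ⟨q, hq, hne⟩ : ∃ q ∈ A.encDom i, A.enc i q ≠ A.enc i (ι x) := by
    refine exists_ne_of_fderiv_ne_zero (A.isOpen_encDom i) (hmem hi) fun h0 => hv (hbij.1 ?_)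
    rw [map_zero]
    simp [tangentEnc, h0]
  have hLE : 0 ≤ LE := (norm_nonneg _).trans (hA.enc_bound i _ (hmem hi))
  have hLD : 0 ≤ LD := (norm_nonneg _).trans (hA.dec_bound i _ ⟨_, hmem hi, rfl⟩)
  have hLE' : 0 ≤ LE' := nonneg_of_norm_le_mul_norm_sub (fun h0 => hne (by rw [h0]))
    (hA.enc_lipschitz i q hq (ι x) (hmem hi))
  have hLD' : 0 ≤ LD' := nonneg_of_norm_le_mul_norm_sub hne
    (hA.dec_lipschitz i _ ⟨q, hq, rfl⟩ _ ⟨_, hmem hi, rfl⟩)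
  set G := fderiv ℝ (A.dec i) (A.enc i (ι x)) with hG
  set Q' := fderiv ℝ (A.enc j) (A.dec i (A.enc i (ι x))) with hQ'
  have hGle : ‖G‖ ≤ LD := hA.dec_bound i _ ⟨_, hmem hi, rfl⟩
  have hQ'le : ‖Q'‖ ≤ LE := hA.enc_bound j _ (A.dec_enc_mem hi hj)
  have hQsub : ‖fderiv ℝ (A.enc j) (ι x) - Q'‖ ≤ LE' * ε := by
    refine (hA.enc_lipschitz j _ (hmem hj) _ (A.dec_enc_mem hi hj)).trans ?_
    rw [norm_sub_rev]
    gcongr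
    exact A.reconstruction i x hi
  have hclose : ‖LinearMap.toContinuousLinearMap h - Q' ∘L G‖
      ≤ (LE * η + LE' * ε) * (LD / (1 - η)) := by
    refine norm_sub_comp_le (W := embeddedTangentSpace d ι x) (P := fderiv ℝ (A.enc i) (ι x))
      hη hη1 (fun y => ?_) (fun w hw => A.norm_dec_enc_sub_le hi hw) ?_ hGle hQ'le hQsub
    · obtain ⟨u, hu⟩ := hbij.2 y
      exact ⟨mdiff d ι x u, ⟨u, rfl⟩, hu⟩
    · rintro w ⟨u, rfl⟩
      exact DFunLike.congr_fun hh u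
  rw [sgn, A.jac_eq_comp hi hj]
  refine sign_det_eq_of_norm_sub_le (h := LinearMap.toContinuousLinearMap h) (c := LE * LD)
    ((ContinuousLinearMap.opNorm_comp_le _ _).trans (by gcongr))
    (hclose.trans (perturbation_ge hε hη hη1 hLE hLE' hLD hLD')) ?_
  rw [← A.jac_eq_comp hi hj]
  exact ((le_max_left _ _).trans_lt hmax).trans_le (A.gap_le_abs_det_jac hi hj)

end ApproxAtlas

/-! ### The orientability criterion -/

/-- The constant `C₀` depends only on the embedded manifold, the number `n` of charts and the
bound `K` on the `C²` norms of the exact atlas. -/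
theorem corollary4p12 {d N : ℕ} {M : Type*} [TopologicalSpace M] [ChartedSpace (Euc d) M]
    [IsManifold (𝓡 d) ∞ M] [CompactSpace M]
    (ι : M → Euc N) (hι : Manifold.IsSmoothEmbedding (𝓡 d) 𝓘(ℝ, Euc N) ∞ ι)
    (n : ℕ) (K : ℝ≥0) :
    ∃ C₀ : ℝ, 0 < C₀ ∧
      ∀ (I : Type*) [Fintype I], Fintype.card I = n →
      ∀ U : I → Set M, IsGoodCover U →
      ∀ (ε η : ℝ) (A : ApproxAtlas d ι U ε η),
        -- regularity and non-degeneracy bounds of the stability theorem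
        0 < A.gap →
        (∃ LE LE' LD LD' : ℝ, A.RegularityBounds LE LE' LD LD' ∧
          StabilityCondition d ε η LE LE' LD LD' A.gap) →
        -- proximity to an exact compatible atlas over the same cover
        (∃ (A₀ : ExactAtlas d U) (μ : ℝ), A₀.C2Bound ι K ∧ 0 < A₀.gap ∧
          0 ≤ μ ∧ C1Close A A₀ μ ∧ μ < A₀.gap / (2 * C₀)) →
        (IsOrientableManifold d M ↔
          ∃ ν : I → ℝ, (∀ i, ν i = 1 ∨ ν i = -1) ∧
            ∀ i j, ∀ x ∈ U i ∩ U j, A.sgn j i x = ν j * ν i) := by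
  -- The stability condition alone pins the signs to the tangent bundle, so any `C₀ > 0` serves.
  refine ⟨1, one_pos, fun I _ _ U hU ε η A _ hreg _ => ?_⟩
  obtain ⟨LE, LE', LD, LD', hA, hst⟩ := hreg
  have : IsManifold (𝓡 d) 1 M := IsManifold.of_le (n := ∞) (by norm_cast)
  have hι1 : ContMDiff (𝓡 d) 𝓘(ℝ, Euc N) 1 ι := hι.contMDiff.of_le (by norm_cast)
  have hinj (x : M) : Function.Injective (mdiff d ι x) :=
    injective_mfderiv_of_isImmersionAt (hι.isImmersion.isImmersionAt x)
  exact isOrientableBundle_iff_sign_coboundary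
    (φ := fun i x => (A.tangentEnc i x).toLinearMap) hU.isOpen hU.covers
    (fun i => have := hU.contractible i
      isPreconnected_iff_preconnectedSpace.2 inferInstance)
    (fun i => A.continuousOn_tangentEnc hι1 i)
    (fun i x hx => A.bijective_tangentEnc hst.1 (hinj x) hx)
    (fun i j x hx h hh => A.sign_det_eq_sgn hA hst (hinj x) hx hh)
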